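/- For a topological space $X$, let $B^{\S}(X)$ be the set of functions $f:X\to\{0,1\}$ such that $\overline{f^{-1}(0)}\cap\overline{f^{-1}(1)}$ has empty interior, and let $B_r^{\S}(X)$ be the set of functions $f:X\to\{0,1\}$ such that $f|_F\in B^{\S}(F)$ for every non-empty closed $F\subseteq X$. Let $L$ be a first-order language, $\kappa$ a cardinal, $\mathcal U$ a $\kappa$-saturated $L$-structure (for instance a monster model of a theory $T$), and $M\prec\mathcal U$ an elementary substructure with $|M|<\kappa$. Let $x,y$ be finite tuples of variables, and let $\phi(x;y)$ be an $L$-formula which is NIP, i.e. there do not exist an infinite set $A$ of $|x|$-tuples of $\mathcal U$ and, for each $I\subseteq A$, a $|y|$-tuple $b_I$ of $\mathcal U$ such that for all $a\in A$: $\mathcal U\models\phi(a;b_I)\iff a\in I$. A global $\phi$-type is a maximal consistent set of formulas $\phi(x;b)$, $\neg\phi(x;b)$ with $b$ in $\mathcal U$. Let $\mathrm{Inv}_\phi(M)$ be the set of global $\phi$-types $p$ that are $M$-invariant, i.e. whether $p\vdash\phi(x;b)$ depends only on $\mathrm{tp}(b/M)$. For $p\in\mathrm{Inv}_\phi(M)$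 let $d_p:S_y(M)\to\{0,1\}$ be defined by $d_p(q)=1$ if $p\vdash\phi(x;b)$ for some (equivalently, any) realization $b$ of $q$ in $\mathcal U$, and $d_p(q)=0$ otherwise. Let $S_{fs}(M)\subseteq S_y(\mathcal U)$ be the subspace of those complete global types in the variable $y$ that are finitely satisfiable in $M$, let $\pi:S_{fs}(M)\to S_y(M)$ be the restriction map, and let $f_p=\pi^*d_p=d_p\circ\pi:S_{fs}(M)\to\{0,1\}$. Then for every $p\in\mathrm{Inv}_\phi(M)$, the function $f_p$ is in $B_r^{\S}(S_{fs}(M))$. -/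

import Mathlib

open FirstOrder FirstOrder.Language Cardinal

universe u v w

noncomputable section

namespace PhiTypes

/-! ### Classes of `{0,1}`-valued functions -/

/-- `f ∈ B^§(X)`: the set `closure (f⁻¹(0)) ∩ closure (f⁻¹(1))` has empty interior. -/
def BSec {X : Type*} [TopologicalSpace X] (f : X → Bool) : Prop :=
  interior (closure (f ⁻¹' {false}) ∩ closure (f ⁻¹' {true})) = ∅

/-- `f ∈ B_r^§(X)`: for every non-empty closed `F ⊆ X`, the restriction of `f` to the subspace
`F` belongs to `B^§(F)`. -/
def BSecR {X : Type*} [TopologicalSpace X] (f : X → Bool) : Prop :=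
  ∀ F : Set X, IsClosed F → F.Nonempty → BSec (F.domRestrict f)

/-! ### Complete types over a set of parameters -/

section Types

variable (L : FirstOrder.Language.{u, v}) {U : Type w} [L.Structure U] [Nonempty U]

/-- `S_n(A)`: complete `n`-types over the parameter set `A ⊆ U`, i.e. complete types over the
`L(A)`-theory of `U`, with the usual (Stone) topology. -/
abbrev TypeSpace (A : Set U) (n : ℕ) : Type _ :=
  (L[[A]].completeTheory U).CompleteType (Fin n)

/-- `tp(b/A)`, the complete type of the tuple `b` of `U` over `A`. -/
abbrev tp (A : Set U) {n : ℕ} (b : Fin n → U) : TypeSpace L A n :=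
  (L[[A]].completeTheory U).typeOf b

/-- `U` is `κ`-saturated: all complete types in finitely many variables over fewer than `κ`
parameters are realized in `U`. -/
def IsSaturated (U : Type w) [L.Structure U] [Nonempty U] (κ : Cardinal.{w}) : Prop :=
  ∀ A : Set U, #A < κ → ∀ (n : ℕ) (q : TypeSpace L A n), ∃ b : Fin n → U, tp L A b = q

variable {L}

/-- The inclusion `L(A) → L(B)` of languages, for `A ⊆ B`. -/
def inclConst {A B : Set U} (h : A ⊆ B) : L[[A]] →ᴸ L[[B]] :=
  L.lhomWithConstantsMap (Set.inclusion h)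

instance inclConst_isExpansionOn {A B : Set U} (h : A ⊆ B) :
    (inclConst (L := L) h).IsExpansionOn U where
  map_onFunction := by
    intro n f x
    rcases f with f | f
    · rfl
    · cases n with
      | zero => rfl
      | succ n => exact isEmptyElim f
  map_onRelation := by
    intro n r x
    rcases r with r | r
    · rfl
    · exact isEmptyElim r

/-- Restriction of complete types from `B` to `A ⊆ B`: a sentence over `A` (in the variables)
is in the restriction of `q` iff, read over `B`, it is in `q`. -/
def restrictType {A B : Set U} (h : A ⊆ B) {n : ℕ} (q : TypeSpace L B n) :
    TypeSpace L A n where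
  toTheory := {θ | ((inclConst h).addConstants (Fin n)).onSentence θ ∈ q}
  subset' := by
    rintro _ ⟨σ, hσ, rfl⟩
    have h1 : (inclConst h).onSentence σ ∈ L[[B]].completeTheory U := by
      rw [mem_completeTheory, LHom.realize_onSentence]
      exact hσ
    have h2 := q.subset (Set.mem_image_of_mem _ h1)
    have h3 : ((inclConst (L := L) h).addConstants (Fin n)).onSentence
          ((L[[A]].lhomWithConstants (Fin n)).onSentence σ) =
        (L[[B]].lhomWithConstants (Fin n)).onSentence ((inclConst h).onSentence σ) := by
      change LHom.onBoundedFormula _ (LHom.onBoundedFormula _ σ) =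
        LHom.onBoundedFormula _ (LHom.onBoundedFormula _ σ)
      rw [← Function.comp_apply (f := LHom.onBoundedFormula _)
          (g := LHom.onBoundedFormula _), ← LHom.comp_onBoundedFormula,
        ← Function.comp_apply (f := LHom.onBoundedFormula _)
          (g := LHom.onBoundedFormula _), ← LHom.comp_onBoundedFormula]
      rfl
    change _ ∈ q
    rw [h3]
    exact h2
  isMaximal' := by
    refine ⟨?_, fun θ => ?_⟩
    · refine Theory.isSatisfiable_of_isSatisfiable_onTheory
        ((inclConst h).addConstants (Fin n)) (q.isMaximal.1.mono ?_)
      rintro _ ⟨θ, hθ, rfl⟩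
      exact hθ
    · exact q.mem_or_not_mem (((inclConst h).addConstants (Fin n)).onSentence θ)

/-- `S_fs(M)`: the global types (types over all of `U`) that are finitely satisfiable in `M`:
every formula of the type is satisfied in `U` by a tuple from `M`. It carries the topology
induced by `S_n(U)`. -/
def FinSatTypes (L : FirstOrder.Language.{u, v}) {U : Type w} [L.Structure U] [Nonempty U]
    (M : Set U) (n : ℕ) : Set (TypeSpace L (Set.univ : Set U) n) :=
  {q | ∀ θ ∈ q, ∃ b : Fin n → U, (∀ i, b i ∈ M) ∧ θ ∈ tp L Set.univ b}

/-- The projection `π : S_fs(M) → S_n(M)`, restriction of a global type to `M`. -/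
def projFS (M : Set U) {n : ℕ} (q : FinSatTypes L M n) : TypeSpace L M n :=
  restrictType (Set.subset_univ M) q.1

end Types

/-! ### `φ`-types -/

section Phi

variable {L : FirstOrder.Language.{u, v}} {U : Type w} [L.Structure U] {m n : ℕ}

/-- `φ(x;y)` is NIP in `U`: there is no infinite set `A` of `|x|`-tuples all of whose subsets `I`
are cut out on `A` by an instance `φ(x;b_I)`. -/
def IsNIP (U : Type w) [L.Structure U] (φ : L.Formula (Fin m ⊕ Fin n)) : Prop :=
  ¬ ∃ A : Set (Fin m → U), A.Infinite ∧
    ∀ I ⊆ A, ∃ b : Fin n → U, ∀ a ∈ A, φ.Realize (Sum.elim a b) ↔ a ∈ I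

/-- A global `φ`-type `p ∈ S_φ(U)`: a maximal consistent set of instances `φ(x;b)`, `¬φ(x;b)`
with `b` in `U`. It is recorded by the set `pos` of those `b` with `φ(x;b) ∈ p`; for the
other `b` one has `¬φ(x;b) ∈ p`. Consistency (over the model `U`) says that any finitely many of
these formulas are satisfied by one tuple `a` of `U`. -/
structure PhiType (U : Type w) [L.Structure U] (φ : L.Formula (Fin m ⊕ Fin n)) where
  /-- the tuples `b` for which `φ(x;b)` belongs to the type -/
  pos : Set (Fin n → U)
  consistent : ∀ s : Finset (Fin n → U), ∃ a : Fin m → U,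
    ∀ b ∈ s, φ.Realize (Sum.elim a b) ↔ b ∈ pos

variable {φ : L.Formula (Fin m ⊕ Fin n)}

/-- `p ∈ Inv_φ(M)`: whether `p ⊢ φ(x;b)` depends only on `tp(b/M)`. -/
def PhiType.IsInvariant [Nonempty U] (p : PhiType U φ) (M : Set U) : Prop :=
  ∀ b b' : Fin n → U, tp L M b = tp L M b' → (b ∈ p.pos ↔ b' ∈ p.pos)

open Classical in
/-- `d_p : S_y(M) → {0,1}`, with `d_p(q) = 1` iff `p ⊢ φ(x;b)` for some realization `b` of `q`
in `U`. -/
def PhiType.d [Nonempty U] (p : PhiType U φ) (M : Set U) (q : TypeSpace L M n) : Bool :=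
  decide (∃ b : Fin n → U, tp L M b = q ∧ b ∈ p.pos)

/-- `f_p = π^* d_p : S_fs(M) → {0,1}`. -/
def PhiType.f [Nonempty U] (p : PhiType U φ) (M : Set U) : FinSatTypes L M n → Bool :=
  p.d M ∘ projFS M

end Phi

end PhiTypes

end

namespace PhiTypes

/-! ### Compactness for formulas over small parameter sets -/

section Saturation

variable {L : FirstOrder.Language.{u, v}} {U : Type w} [L.Structure U]

/-! If `f_p` fails the condition on `F`, both of its fibres are dense in some non-empty relatively
open `W ⊆ F`. Let `H` be the image of `W` in `S_y(M)`: near every type of `H`, up to finitely many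
formulas, there are types of `H` with either value of `d_p`. This yields arbitrarily long shattered
sequences (`exists_shattered_by_realizations`). To add a term, split each given type into two nearby
types of `H`, one per value of `d_p`, apply induction to the doubled family, and let the new term
realize `p` on the finitely many realizations obtained; the value of `d_p` becomes the new bit.
Saturation turns "nearby" into equality. By saturation again, long finite shattered sequences give
an infinite shattered set, against NIP (`not_isNIP_of_shatters`); if `κ ≤ ℵ₀`, `U` is finite and
pigeonhole suffices. -/

theorem typeSpace_eq_of_le {A : Set U} {n : ℕ} {q q' : TypeSpace L A n}
    (h : ∀ θ ∈ q, θ ∈ q') : q' = q := by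
  refine SetLike.ext fun θ => ⟨fun hθ => ?_, h θ⟩
  by_contra hn
  exact (q'.not_mem_iff θ).1 (h _ ((q.not_mem_iff θ).2 hn)) hθ

variable [Nonempty U]

/-- A finitely satisfiable family of formulas in finitely many variables over a small set of
parameters is realized in a saturated structure. -/
theorem IsSaturated.exists_realize {κ : Cardinal.{w}} (hU : IsSaturated L U κ) {A : Set U}
    (hA : #A < κ) {α : Type*} [Finite α] {ι : Type*} (ψ : ι → L[[A]].Formula α)
    (h : ∀ t : Finset ι, ∃ v : α → U, ∀ i ∈ t, (ψ i).Realize v) :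
    ∃ v : α → U, ∀ i, (ψ i).Realize v := by
  obtain ⟨n, ⟨e⟩⟩ := Finite.exists_equiv_fin α
  let θ : ι → L[[A]][[Fin n]].Sentence := fun i => Formula.equivSentence ((ψ i).relabel e)
  have hθ : ∀ (i : ι) (b : Fin n → U), θ i ∈ tp L A b ↔ (ψ i).Realize (b ∘ e) := fun i b => by
    rw [Theory.CompleteType.formula_mem_typeOf, Formula.realize_relabel]
  have hne : (⋂ i, (L[[A]].completeTheory U).typesWith (θ i)).Nonempty := by
    refine CompactSpace.iInter_nonempty (fun i => CompleteType.isClosed_typesWith _) fun t => ?_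
    obtain ⟨v, hv⟩ := h t
    refine ⟨tp L A (v ∘ e.symm), Set.mem_iInter₂.2 fun i hi => ?_⟩
    refine (hθ i _).2 ?_
    simpa [Function.comp_assoc] using hv i hi
  obtain ⟨q, hq⟩ := hne
  obtain ⟨b, rfl⟩ := hU A hA n q
  exact ⟨b ∘ e, fun i => (hθ i b).1 (Set.mem_iInter.1 hq i)⟩

end Saturation

/-! ### From finite to infinite shattered sets -/

section Shatter

variable {L : FirstOrder.Language.{u, v}} {U : Type w} [L.Structure U]

/-- The formula `ψ` or its negation, according to a Boolean. -/
def signed {L : FirstOrder.Language.{u, v}} {α : Type*} (ε : Bool) (ψ : L.Formula α) :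
    L.Formula α :=
  bif ε then ψ else ψ.not

theorem realize_signed {α : Type*} (ε : Bool) (ψ : L.Formula α) (x : α → U) :
    (signed ε ψ).Realize x ↔ (ψ.Realize x ↔ ε = true) := by
  cases ε <;> simp [signed, Formula.realize_not]

variable {m n : ℕ}

/-- The first `N` terms of the sequence `a` are shattered by the instances of `φ`. -/
def Shatters (φ : L.Formula (Fin m ⊕ Fin n)) (N : ℕ) (a : ℕ → Fin m → U) : Prop :=
  ∀ η : ℕ → Bool, ∃ b : Fin n → U, ∀ i < N, φ.Realize (Sum.elim (a i) b) ↔ η i = true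

/-- The formula expressing that a sequence of length `N` is shattered by `φ`. -/
noncomputable def shatterFormula (φ : L.Formula (Fin m ⊕ Fin n)) (N : ℕ) :
    L.Formula (Fin N × Fin m) :=
  Formula.iInf fun η : Fin N → Bool => Formula.iExs (Fin n) <| Formula.iInf fun i : Fin N =>
    signed (η i) (φ.relabel (Sum.map (Prod.mk i) id))

theorem realize_shatterFormula (φ : L.Formula (Fin m ⊕ Fin n)) (N : ℕ) (a : ℕ → Fin m → U) :
    (shatterFormula φ N).Realize (fun z : Fin N × Fin m => a z.1 z.2) ↔ Shatters φ N a := by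
  have key : ∀ (i : Fin N) (b : Fin n → U),
      (Sum.elim (fun z : Fin N × Fin m => a z.1 z.2) b) ∘ Sum.map (Prod.mk i) id =
        Sum.elim (a i) b := fun i b => by
    funext z; cases z <;> rfl
  simp only [shatterFormula, Formula.realize_iInf, Formula.realize_iExs, realize_signed,
    Formula.realize_relabel, key]
  constructor
  · intro h η
    obtain ⟨b, hb⟩ := h fun i => η i
    exact ⟨b, fun i hi => hb ⟨i, hi⟩⟩
  · intro h η
    obtain ⟨b, hb⟩ := h fun i => if hi : i < N then η ⟨i, hi⟩ else false
    refine ⟨b, fun i => ?_⟩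
    simpa using hb i i.2

theorem Shatters.mono {φ : L.Formula (Fin m ⊕ Fin n)} {N N' : ℕ} {a : ℕ → Fin m → U}
    (h : Shatters φ N' a) (hN : N ≤ N') : Shatters φ N a := fun η =>
  (h η).imp fun _ hb i hi => hb i (hi.trans_le hN)

theorem Shatters.congr {φ : L.Formula (Fin m ⊕ Fin n)} {N : ℕ} {a a' : ℕ → Fin m → U}
    (h : Shatters φ N a) (ha : ∀ i < N, a' i = a i) : Shatters φ N a' := fun η =>
  (h η).imp fun _ hb i hi => by rw [ha i hi]; exact hb i hi

/-- The instance whose pattern is true only at `i` separates `a i` from every other term. -/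
theorem Shatters.eq_of_eq {φ : L.Formula (Fin m ⊕ Fin n)} {N : ℕ} {a : ℕ → Fin m → U}
    (h : Shatters φ N a) {i j : ℕ} (hi : i < N) (hj : j < N) (hij : a i = a j) : i = j := by
  obtain ⟨b, hb⟩ := h fun l => decide (l = i)
  have h1 := (hb i hi).2 (by simp)
  rw [hij] at h1
  exact (of_decide_eq_true ((hb j hj).1 h1)).symm

variable [Nonempty U]

/-- The first `k` terms of `a` extend to arbitrarily long shattered sequences. -/
def ExtendsToShattered (φ : L.Formula (Fin m ⊕ Fin n)) (k : ℕ) (a : ℕ → Fin m → U) : Prop :=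
  ∀ N, ∃ a' : ℕ → Fin m → U, (∀ i < k, a' i = a i) ∧ Shatters φ N a'

/-- Saturation handles finite tuples only, so an infinite sequence is built term by term; the terms
still to come are existentially quantified. -/
theorem ExtendsToShattered.exists_update {κ : Cardinal.{w}} (hU : IsSaturated L U κ)
    (hκ : ℵ₀ ≤ κ) {φ : L.Formula (Fin m ⊕ Fin n)} {k : ℕ} {a : ℕ → Fin m → U}
    (h : ExtendsToShattered φ k a) :
    ∃ x : Fin m → U, ExtendsToShattered φ (k + 1) (Function.update a k x) := by
  classical
  let A : Set U := Set.range fun z : Fin k × Fin m => a z.1 z.2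
  have hA : #A < κ := (Cardinal.lt_aleph0_iff_finite.2 (Set.finite_range _).to_subtype).trans_le hκ
  -- Earlier terms become constants, term `k` the free variable, later terms bound variables.
  let t : ∀ N : ℕ, Fin N × Fin m → L[[A]].Term (Fin m ⊕ (Fin N × Fin m)) := fun N z =>
    if hz : (z.1 : ℕ) < k then Constants.term (L.con (⟨a z.1 z.2, ⟨(⟨z.1, hz⟩, z.2), rfl⟩⟩ : A))
    else if (z.1 : ℕ) = k then Term.var (Sum.inl z.2) else Term.var (Sum.inr z)
  let ψ : ℕ → L[[A]].Formula (Fin m) := fun N =>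
    Formula.iExs (Fin N × Fin m)
      (((L.lhomWithConstants A).onFormula (shatterFormula φ N)).subst (t N))
  let s : (Fin m → U) → (ℕ → Fin m → U) → ℕ → Fin m → U := fun x w i =>
    if i < k then a i else if i = k then x else w i
  have hψ : ∀ N (x : Fin m → U), (ψ N).Realize x ↔
      ∃ w : Fin N × Fin m → U, (shatterFormula φ N).Realize (fun z : Fin N × Fin m =>
        s x (fun i l => if hi : i < N then w (⟨i, hi⟩, l) else x l) z.1 z.2) := by
    intro N x
    simp only [ψ, Formula.realize_iExs]
    refine exists_congr fun w => ?_
    rw [Formula.Realize, BoundedFormula.realize_subst]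
    refine (LHom.realize_onFormula _ _).trans (iff_of_eq (congrArg _ (funext fun z => ?_)))
    simp only [t, s]
    split_ifs with h1 h2 h3
    · simp
    · simp
    · simp
    · exact absurd z.1.2 h3
  obtain ⟨x, hx⟩ := hU.exists_realize hA ψ (by
    intro T
    obtain ⟨a', ha', hs⟩ := h (T.sup id)
    refine ⟨a' k, fun N hN => (hψ N _).2 ⟨fun z => a' z.1 z.2, ?_⟩⟩
    rw [realize_shatterFormula]
    refine (hs.mono (Finset.le_sup (f := id) hN)).congr fun i hi => ?_
    funext l
    simp only [s]
    split_ifs with h1 h2 h3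
    · rw [ha' i h1]
    · rw [h2]
    · rfl
    · exact absurd hi h3)
  refine ⟨x, fun N => ?_⟩
  obtain ⟨w, hw⟩ := (hψ N x).1 (hx N)
  rw [realize_shatterFormula] at hw
  refine ⟨_, fun i hi => ?_, hw⟩
  simp only [s]
  rcases Nat.lt_succ_iff_lt_or_eq.1 hi with hi | rfl
  · simp [hi, hi.ne]
  · simp

theorem exists_shattered_sequence {κ : Cardinal.{w}} (hU : IsSaturated L U κ)
    (hκ : ℵ₀ ≤ κ) {φ : L.Formula (Fin m ⊕ Fin n)}
    (h : ∀ N, ∃ a : ℕ → Fin m → U, Shatters φ N a) :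
    ∃ a : ℕ → Fin m → U, ∀ N, Shatters φ N a := by
  choose x hx using fun (k : ℕ) (a : {a : ℕ → Fin m → U // ExtendsToShattered φ k a}) =>
    a.2.exists_update hU hκ
  let s : ∀ k, {a : ℕ → Fin m → U // ExtendsToShattered φ k a} := fun k =>
    Nat.rec ⟨fun _ _ => Classical.arbitrary U, fun N => (h N).imp fun _ ha => ⟨by simp, ha⟩⟩
      (fun k a => ⟨Function.update a.1 k (x k a), hx k a⟩) k
  have hs : ∀ k, (s (k + 1)).1 = Function.update (s k).1 k (x k (s k)) := fun _ => rfl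
  -- Entry `i` is fixed from stage `i + 1` on, so the diagonal sequence agrees with stage `N` below
  -- `N`.
  have hstab : ∀ k i, i < k → (s k).1 i = (s (i + 1)).1 i := by
    intro k i hik
    induction k, hik using Nat.le_induction with
    | base => rfl
    | succ k hk ih =>
      rw [hs k, Function.update_of_ne (by omega), ih]
  refine ⟨fun i => (s (i + 1)).1 i, fun N => ?_⟩
  obtain ⟨a', ha', hN⟩ := (s N).2 N
  exact hN.congr fun i hi => by rw [ha' i hi, hstab N i hi]

/-- In a sufficiently saturated structure, arbitrarily long finite shattered sequences yield an
infinite shattered set. -/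
theorem not_isNIP_of_shatters {κ : Cardinal.{w}} (hU : IsSaturated L U κ)
    (hκ : ℵ₀ < κ) {φ : L.Formula (Fin m ⊕ Fin n)}
    (h : ∀ N, ∃ a : ℕ → Fin m → U, Shatters φ N a) : ¬ IsNIP U φ := by
  classical
  obtain ⟨a, ha⟩ := exists_shattered_sequence hU hκ.le h
  have hinj : Function.Injective a := fun i j hij =>
    (ha (max i j + 1)).eq_of_eq (by omega) (by omega) hij
  rw [IsNIP, not_not]
  refine ⟨Set.range a, Set.infinite_range_of_injective hinj, fun I _ => ?_⟩
  let A : Set U := Set.range fun z : ℕ × Fin m => a z.1 z.2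
  have hA : #A < κ :=
    (Cardinal.mk_le_aleph0_iff.2 (Set.countable_range _).to_subtype).trans_lt hκ
  let t : ℕ → Fin m ⊕ Fin n → L[[A]].Term (Fin n) := fun i =>
    Sum.elim (fun l => Constants.term (L.con (⟨a i l, ⟨(i, l), rfl⟩⟩ : A))) Term.var
  let ψ : ℕ → L[[A]].Formula (Fin n) := fun i =>
    signed (decide (a i ∈ I)) (((L.lhomWithConstants A).onFormula φ).subst (t i))
  have hψ : ∀ i b, (ψ i).Realize b ↔ (φ.Realize (Sum.elim (a i) b) ↔ a i ∈ I) := by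
    intro i b
    rw [realize_signed, decide_eq_true_iff, Formula.Realize, BoundedFormula.realize_subst]
    refine iff_congr ((LHom.realize_onFormula _ _).trans
      (iff_of_eq (congrArg _ (funext fun z => ?_)))) Iff.rfl
    cases z <;> simp [t]
  obtain ⟨b, hb⟩ := hU.exists_realize hA ψ (by
    intro T
    obtain ⟨b, hb⟩ := ha (T.sup id + 1) fun i => decide (a i ∈ I)
    refine ⟨b, fun i hi => (hψ i b).2 ?_⟩
    simpa using hb i (Nat.lt_succ_of_le (Finset.le_sup (f := id) hi)))
  refine ⟨b, ?_⟩
  rintro _ ⟨i, rfl⟩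
  exact (hψ i b).1 (hb i)

end Shatter

/-! ### Shattering from density of both truth values -/

section Main

variable {L : FirstOrder.Language.{u, v}} {U : Type w} [L.Structure U] [Nonempty U] {m n : ℕ}

/-- Let `H` be a set of types over a small set `A` on which both truth values of `p` are dense.
Then for every `k` and finitely many types of `H` there is a sequence such that every pattern on
its first `k` terms is cut out by a realization of each of these types. -/
theorem exists_shattered_by_realizations {κ : Cardinal.{w}} (hU : IsSaturated L U κ) {A : Set U}
    (hA : #A < κ) {φ : L.Formula (Fin m ⊕ Fin n)} (p : PhiType U φ) {H : Set (TypeSpace L A n)}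
    (hH : ∀ q ∈ H, ∀ S : Set (L[[A]][[Fin n]].Sentence), S.Finite → (∀ θ ∈ S, θ ∈ q) →
      ∀ ε : Bool, ∃ q' ∈ H, (∀ θ ∈ S, θ ∈ q') ∧
        ∀ b : Fin n → U, tp L A b = q' → (b ∈ p.pos ↔ ε = true)) (k : ℕ) :
    ∀ {ι : Type} [Finite ι] (q : ι → TypeSpace L A n), (∀ j, q j ∈ H) →
      ∃ a : ℕ → Fin m → U, ∀ j, ∀ η : ℕ → Bool, ∃ b : Fin n → U, tp L A b = q j ∧
        ∀ i < k, φ.Realize (Sum.elim (a i) b) ↔ η i = true := by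
  classical
  induction k with
  | zero =>
    intro ι _ q _
    refine ⟨fun _ _ => Classical.arbitrary U, fun j _ => ?_⟩
    obtain ⟨b, hb⟩ := hU A hA n (q j)
    exact ⟨b, hb, by simp⟩
  | succ k ih =>
    intro ι _ q hq
    have := Fintype.ofFinite ι
    -- A pair in `P` is a type together with a pattern; each gets its own block of variables for a
    -- realization.
    let P : Type := ι × (Fin (k + 1) → Bool)
    let V : Type := (Fin (k + 1) × Fin m) ⊕ (P × Fin n)
    let J := (Fin (k + 1) × P) ⊕ (Σ c : P, {θ : L[[A]][[Fin n]].Sentence // θ ∈ q c.1})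
    let ψ : J → L[[A]].Formula V := Sum.elim
      (fun z => signed (z.2.2 z.1) (((L.lhomWithConstants A).onFormula φ).relabel
        (Sum.map (Prod.mk z.1) (Prod.mk z.2))))
      (fun z => (Formula.equivSentence.symm z.2.1).relabel fun l => Sum.inr (z.1, l))
    let val : (ℕ → Fin m → U) → (P → Fin n → U) → V → U := fun a b =>
      Sum.elim (fun z => a z.1 z.2) (fun z => b z.1 z.2)
    have hψ₁ : ∀ i c a b, (ψ (Sum.inl (i, c))).Realize (val a b) ↔
        (φ.Realize (Sum.elim (a i) (b c)) ↔ c.2 i = true) := by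
      intro i c a b
      simp only [ψ, Sum.elim_inl, realize_signed, Formula.realize_relabel,
        LHom.realize_onFormula]
      refine iff_congr (iff_of_eq (congrArg _ (funext fun z => ?_))) Iff.rfl
      cases z <;> rfl
    have hψ₂ : ∀ c θ a b, (ψ (Sum.inr ⟨c, θ⟩)).Realize (val a b) ↔ θ.1 ∈ tp L A (b c) := by
      intro c θ a b
      simp only [ψ, Sum.elim_inr, Formula.realize_relabel, Theory.CompleteType.mem_typeOf]
      rfl
    obtain ⟨w, hw⟩ := hU.exists_realize hA ψ (by
      intro T
      -- The finite part of `q j` that `T` mentions.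
      let S : ι → Set (L[[A]][[Fin n]].Sentence) := fun j =>
        {θ | ∃ η, ∃ hθ : θ ∈ q j, (Sum.inr ⟨(j, η), ⟨θ, hθ⟩⟩ : J) ∈ T}
      have hS : ∀ j, (S j).Finite := fun j => by
        refine (T.finite_toSet.image fun z : J => Sum.elim (fun _ => ⊥)
          (fun z => (z.2.1 : L[[A]][[Fin n]].Sentence)) z).subset ?_
        rintro θ ⟨η, hθ, hT⟩
        exact ⟨_, hT, rfl⟩
      choose q' hq'H hq'S hq'p using fun z : ι × Bool =>
        hH (q z.1) (hq z.1) (S z.1) (hS z.1) (fun _ ⟨_, h, _⟩ => h) z.2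
      obtain ⟨a, ha⟩ := ih q' hq'H
      -- Induction supplies the first `k` bits of the pattern; the last bit selects which of the two
      -- nearby types to realize.
      choose b hb hba using fun c : P =>
        ha (c.1, c.2 (Fin.last k)) fun i => if hi : i < k + 1 then c.2 ⟨i, hi⟩ else false
      -- The new term realizes `p` on all the chosen realizations at once.
      obtain ⟨x, hx⟩ := p.consistent (Finset.univ.image b)
      refine ⟨val (Function.update a k x) b, ?_⟩
      rintro (⟨i, c⟩ | ⟨⟨j, η⟩, θ⟩) hT
      · refine (hψ₁ i c _ _).2 ?_
        induction i using Fin.lastCases with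
        | last =>
          rw [Fin.val_last, Function.update_self,
            hx _ (Finset.mem_image_of_mem b (Finset.mem_univ c))]
          exact hq'p _ _ (hb c)
        | cast i =>
          have := hba c i i.2
          rw [dif_pos (by omega)] at this
          rw [Fin.val_castSucc, Function.update_of_ne i.2.ne]
          exact this
      · refine (hψ₂ _ _ _ _).2 ?_
        rw [hb]
        exact hq'S _ _ ⟨η, θ.2, hT⟩)
    refine ⟨fun i l => if hi : i < k + 1 then w (Sum.inl (⟨i, hi⟩, l)) else w (Sum.inl (0, l)),
      fun j η => ?_⟩
    set a : ℕ → Fin m → U :=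
      fun i l => if hi : i < k + 1 then w (Sum.inl (⟨i, hi⟩, l)) else w (Sum.inl (0, l)) with ha
    have hval : w = val a fun c l => w (Sum.inr (c, l)) := by
      funext z
      rcases z with ⟨i, l⟩ | z
      · have : a i l = w (Sum.inl (i, l)) := by simp only [ha, dif_pos i.2]
        exact this.symm
      · rfl
    let c : P := (j, fun i => η i)
    refine ⟨fun l => w (Sum.inr (c, l)), typeSpace_eq_of_le fun θ hθ => ?_, fun i hi => ?_⟩
    · have := hw (Sum.inr ⟨c, ⟨θ, hθ⟩⟩)
      rw [hval] at this
      exact (hψ₂ c ⟨θ, hθ⟩ a fun c l => w (Sum.inr (c, l))).1 this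
    · have := hw (Sum.inl (⟨i, hi⟩, c))
      rw [hval] at this
      exact (hψ₁ ⟨i, hi⟩ c a fun c l => w (Sum.inr (c, l))).1 this

/-- A formula is not NIP if some non-empty set of types over a small elementary substructure has
both truth values of a `φ`-type dense in it. -/
theorem not_isNIP_of_dense {κ : Cardinal.{w}} (hU : IsSaturated L U κ)
    (M : L.ElementarySubstructure U) (hM : #M < κ) {φ : L.Formula (Fin m ⊕ Fin n)}
    (p : PhiType U φ) {H : Set (TypeSpace L (M : Set U) n)} (hne : H.Nonempty)
    (hH : ∀ q ∈ H, ∀ S : Set (L[[(M : Set U)]][[Fin n]].Sentence), S.Finite →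
      (∀ θ ∈ S, θ ∈ q) → ∀ ε : Bool, ∃ q' ∈ H, (∀ θ ∈ S, θ ∈ q') ∧
        ∀ b : Fin n → U, tp L (M : Set U) b = q' → (b ∈ p.pos ↔ ε = true)) :
    ¬ IsNIP U φ := by
  obtain ⟨q, hq⟩ := hne
  have hsh : ∀ N, ∃ a : ℕ → Fin m → U, Shatters φ N a := fun N => by
    obtain ⟨a, ha⟩ := exists_shattered_by_realizations hU hM p hH N (fun _ : Unit => q)
      fun _ => hq
    exact ⟨a, fun η => (ha () η).imp fun _ hb => hb.2⟩
  rcases lt_or_ge ℵ₀ κ with hκ | hκ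
  · exact not_isNIP_of_shatters hU hκ hsh
  -- A finite `M` forces its elementary extension `U` to be finite, bounding the length of a
  -- shattered sequence.
  · have hMfin : Finite M := Cardinal.lt_aleph0_iff_finite.1 (hM.trans_le hκ)
    have hUfin : Finite U := by
      by_contra hinf
      rw [not_finite_iff_infinite] at hinf
      exact not_finite_iff_infinite.2 (M.elementarilyEquivalent.infinite_iff.2 hinf) hMfin
    have := Fintype.ofFinite (Fin m → U)
    obtain ⟨a, ha⟩ := hsh (Fintype.card (Fin m → U) + 1)
    have hinj : Function.Injective fun i : Fin (Fintype.card (Fin m → U) + 1) => a i :=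
      fun i j hij => Fin.ext (ha.eq_of_eq i.2 j.2 hij)
    have := Fintype.card_le_of_injective _ hinj
    rw [Fintype.card_fin] at this
    omega

theorem isOpen_setOf_mem_projFS (A : Set U) (θ : L[[A]][[Fin n]].Sentence) :
    IsOpen {x : FinSatTypes L A n | θ ∈ projFS A x} :=
  (CompleteType.isOpen_typesWith _).preimage continuous_subtype_val

theorem PhiType.IsInvariant.mem_pos_iff {φ : L.Formula (Fin m ⊕ Fin n)} {p : PhiType U φ}
    {A : Set U} (hp : p.IsInvariant A) (b : Fin n → U) :
    b ∈ p.pos ↔ p.d A (tp L A b) = true := by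
  classical
  rw [PhiType.d, decide_eq_true_iff]
  exact ⟨fun h => ⟨b, rfl, h⟩, fun ⟨b', hb', h⟩ => (hp b' b hb').1 h⟩

end Main

end PhiTypes


theorem mainTheorem8 {L : FirstOrder.Language.{u, v}} {U : Type w} [L.Structure U] [Nonempty U]
    (κ : Cardinal.{w}) (hU : PhiTypes.IsSaturated L U κ)
    (M : L.ElementarySubstructure U) (hM : Cardinal.mk M < κ)
    {m n : ℕ} (φ : L.Formula (Fin m ⊕ Fin n)) (hφ : PhiTypes.IsNIP U φ)
    (p : PhiTypes.PhiType U φ) (hp : p.IsInvariant (M : Set U)) :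
    PhiTypes.BSecR (p.f (M : Set U)) := by
  intro F _ _
  rw [PhiTypes.BSec, ← Set.not_nonempty_iff_eq_empty]
  intro hne
  let g : F → PhiTypes.TypeSpace L (M : Set U) n := fun x => PhiTypes.projFS (M : Set U) x.1
  set W := interior (closure (F.domRestrict (p.f (M : Set U)) ⁻¹' {false}) ∩
    closure (F.domRestrict (p.f (M : Set U)) ⁻¹' {true}))
  refine PhiTypes.not_isNIP_of_dense hU M hM p (H := g '' W) (hne.image g) ?_ hφ
  rintro _ ⟨x, hx, rfl⟩ S hS hSx ε
  -- Finitely many formulas cut out an open neighbourhood of `x` inside `W`, which meets both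
  -- fibres.
  have hO : IsOpen (W ∩ ⋂ θ ∈ S, {y : F | θ ∈ g y}) :=
    isOpen_interior.inter (hS.isOpen_biInter fun θ _ =>
      (PhiTypes.isOpen_setOf_mem_projFS _ θ).preimage continuous_subtype_val)
  have hcl : x ∈ closure (F.domRestrict (p.f (M : Set U)) ⁻¹' {ε}) := by
    cases ε
    · exact (interior_subset hx).1
    · exact (interior_subset hx).2
  obtain ⟨y, ⟨hyW, hyS⟩, hy⟩ := mem_closure_iff.1 hcl _ hO ⟨hx, Set.mem_iInter₂.2 hSx⟩
  refine ⟨g y, ⟨y, hyW, rfl⟩, Set.mem_iInter₂.1 hyS, fun b hb => ?_⟩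
  rw [hp.mem_pos_iff, hb]
  exact iff_of_eq (congrArg (· = true) hy)
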